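/- Let $A\subset\mathbb Z\setminus\{0\}$ be a finite set that affinely generates $\mathbb Z$. For a polytope $P\subset\mathbb R\times E$ ($E$ a finite-dimensional real vector space) with projection $\pi:\mathbb R\times E\to\mathbb R$, let the Minkowski integral $\int\pi|_P\subset E$ be the set of all integrals $\int_{\pi(P)}s(x)\,dx$, where $s:\pi(P)\to E$ runs over the measurable maps with $(x,s(x))\in P$ for all $x\in\pi(P)$. In $\mathbb R^{2}\times\mathbb R^A$ with basis $e_1,e_2,(\alpha_a)_{a\in A}$ put $\Omega_A=\operatorname{conv}\big(\{a\,e_1+\alpha_a\mid a\in A\}\cup\{e_2\}\big)$. Let $\mathcal S_{A\cup 0}=\int\rho_1|_{\Omega_A}\subset\mathbb R\langle e_2\rangle\oplus\mathbb R^A$ be its Minkowski integral with respect to the projection $\rho_1$ to the $e_1$-coordinate, and $\Sigma_A=\int\rho_2|_{\mathcal S_{A\cup 0}}\subset\mathbb R^A$ the Minkowski integral of the latter with respect to the projection $\rho_2$ to the $e_2$-coordinate. For $\gamma:A\to\mathbb R_{\ge 0}$ (a covector on $\mathbb R^A$ with non-negative coordinates) let $\overline\Delta_\gamma\subset\mathbb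 R^3$ be the convex hull of the points $(a,0,0)$ and $(a,0,\gamma(a))$, $a\in A$, and the point $(0,1,0)$, and let $\overline P_\gamma=\int\pi_1|_{\overline\Delta_\gamma}\subset\mathbb R^2$ be its Minkowski integral with respect to the projection $\pi_1$ to the first coordinate. Then $\Sigma_A$ is a polytope; it is homogeneous, i.e. it lies in an affine hyperplane perpendicular to $(1,\ldots,1)$; and for every $\gamma:A\to\mathbb R_{\ge 0}$ its support function satisfies $$\max_{y\in\Sigma_A}\sum_{a\in A}\gamma(a)\,y_a=\operatorname{area}(\overline P_\gamma).$$ Moreover, $\Sigma_A$ is the only homogeneous polytope in $\mathbb R^A$ whose support function has these values on all covectors with non-negative coordinates. -/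

import Mathlib

open MeasureTheory

namespace MinkowskiInt

/-- The Minkowski integral of `P ⊆ F × E` with respect to the projection `F × E → F`:
the set of all integrals `∫_Q s(x) dx` over the image `Q` of `P` in `F`,
where `s` runs over the integrable selections of the fibers of `P` over `Q`.
(For a bounded `P` integrability is just measurability of `s` on `Q`.) -/
def minkowskiIntegral {F E : Type*} [MeasureSpace F] [NormedAddCommGroup E] [NormedSpace ℝ E]
    (P : Set (F × E)) : Set E :=
  {y | ∃ s : F → E, IntegrableOn s (Prod.fst '' P) ∧ (∀ x ∈ Prod.fst '' P, (x, s x) ∈ P) ∧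
    ∫ x in Prod.fst '' P, s x = y}

/-- A (nonempty) polytope: the convex hull of a nonempty finite set of points. -/
def IsPolytope {E : Type*} [AddCommGroup E] [Module ℝ E] (Q : Set E) : Prop :=
  ∃ V : Finset E, V.Nonempty ∧ Q = convexHull ℝ (V : Set E)

/-- `Q ⊆ ℝ^ι` lies in an affine hyperplane perpendicular to `(1, …, 1)`. -/
def IsHomogeneous {ι : Type*} [Fintype ι] (Q : Set (ι → ℝ)) : Prop :=
  ∃ c : ℝ, ∀ y ∈ Q, ∑ i, y i = c

/-- The support function of `Q ⊆ ℝ^ι` at the covector `γ`, i.e. the maximum of `γ` on `Q`. -/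
noncomputable def supportFunction {ι : Type*} [Fintype ι] (Q : Set (ι → ℝ)) (γ : ι → ℝ) : ℝ :=
  sSup ((fun y : ι → ℝ => ∑ i, γ i * y i) '' Q)

/-- The simplex `Ω_A` with vertices `a e₁ + α_a` for `a ∈ A`, and `e₂`.
The space `ℝ × (ℝ × (A → ℝ))` has the coordinates `e₁`, `e₂`, `(α_a)_{a ∈ A}`. -/
def Omega (A : Finset ℤ) : Set (ℝ × (ℝ × (A → ℝ))) :=
  convexHull ℝ (Set.range (fun a : A => (((a : ℤ) : ℝ), ((0 : ℝ), (Pi.single a 1 : A → ℝ)))) ∪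
    {((0 : ℝ), ((1 : ℝ), (0 : A → ℝ)))})

/-- The Minkowski integral of `Ω_A` with respect to the projection to the `e₁`-coordinate. -/
def secondary (A : Finset ℤ) : Set (ℝ × (A → ℝ)) :=
  minkowskiIntegral (Omega A)

/-- The Minkowski integral of the previous polytope with respect to the projection to the
`e₂`-coordinate. -/
def Sigma (A : Finset ℤ) : Set (A → ℝ) :=
  minkowskiIntegral (secondary A)

/-- The polytope with vertices among `(a, 0, 0)`, `(a, 0, γ(a))` and `(0, 1, 0)` in `ℝ³`. -/
def DeltaBar (A : Finset ℤ) (γ : A → ℝ) : Set (ℝ × (ℝ × ℝ)) :=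
  convexHull ℝ (Set.range (fun a : A => (((a : ℤ) : ℝ), ((0 : ℝ), (0 : ℝ)))) ∪
    Set.range (fun a : A => (((a : ℤ) : ℝ), ((0 : ℝ), γ a))) ∪
    {((0 : ℝ), ((1 : ℝ), (0 : ℝ)))})

/-- The polygon obtained as the Minkowski integral of `DeltaBar A γ` with respect to the
projection to the `e₁`-coordinate. -/
def PBar (A : Finset ℤ) (γ : A → ℝ) : Set (ℝ × ℝ) :=
  minkowskiIntegral (DeltaBar A γ)

/-- The area of a plane set. -/
noncomputable def area (S : Set (ℝ × ℝ)) : ℝ := (volume S).toReal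

end MinkowskiInt

/-! A linear functional is maximised on a Minkowski integral by maximising it on every fibre
(`IsSelection.apply_integral_le`). Hence the support function of `Sigma A` at `γ` is `∫ h`, where `h
y` is the maximum of `γ` on the fibre of `secondary A` over `y`. For `γ ≥ 0` the set `PBar A γ` is
the region between the axis and the graph of `h` (`mem_PBar_iff`), so its area is `∫ h` too. To see
this, lift to `OmegaBar γ`, which projects to both `Omega A` and `DeltaBar A γ`: Minkowski integrals
of polytopes commute with linear maps of the fibers (`minkowskiIntegral_image`).

Polytopality: optimal selections can be chosen piecewise linear, with breakpoints under the vertices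
and values there in finite sets, so finitely many integrals suffice for all functionals
(`exists_finite_optimal`), and Hahn–Banach concludes.

Uniqueness: on a homogeneous polytope, adding a multiple of `(1, …, 1)` to a covector shifts it by a
constant, so non-negative covectors suffice. -/

namespace MinkowskiInt

/-! ### Fibres of a polytope over the line -/

section
variable {E : Type*} [AddCommGroup E] [Module ℝ E]

/-- The point over `x` of the line through `u` and `v`. -/
noncomputable def chord (u v : ℝ × E) (x : ℝ) : E :=
  u.2 + ((x - u.1) / (v.1 - u.1)) • (v.2 - u.2)

lemma chord_mem {P : Set (ℝ × E)} (hP : Convex ℝ P) {u v : ℝ × E} (hu : u ∈ P) (hv : v ∈ P)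
    {x : ℝ} (hux : u.1 ≤ x) (hxv : x ≤ v.1) : (x, chord u v x) ∈ P := by
  rcases eq_or_lt_of_le (hux.trans hxv) with h | h
  · have hx : x = u.1 := le_antisymm (hxv.trans h.ge) hux
    have : (x, chord u v x) = u := by ext <;> simp [chord, hx]
    rwa [this]
  · have hd : 0 < v.1 - u.1 := by linarith
    have := hP.add_smul_sub_mem hu hv (t := (x - u.1) / (v.1 - u.1))
      ⟨by have := sub_nonneg.2 hux; positivity, by rw [div_le_one hd]; linarith⟩
    convert this using 1
    ext
    · simp; field_simp; ring
    · simp [chord]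

/-- A chord is affine in `x`. The hypothesis `hij` covers `i = j`, where the quotients are divisions
by zero. -/
lemma chord_interpolate (u v : ℝ × E) {i j x : ℝ} (hij : i = j → x = i) :
    chord u v x = (1 - (x - i) / (j - i)) • chord u v i + ((x - i) / (j - i)) • chord u v j := by
  rcases eq_or_ne i j with h | h
  · obtain rfl := hij h
    simp
  · have : j - i ≠ 0 := sub_ne_zero.2 h.symm
    have key : (x - u.1) / (v.1 - u.1) = (1 - (x - i) / (j - i)) * ((i - u.1) / (v.1 - u.1)) +
        ((x - i) / (j - i)) * ((j - u.1) / (v.1 - u.1)) := by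
      rw [mul_div_assoc', mul_div_assoc', ← add_div]
      congr 1
      field_simp
      ring
    rw [chord, key]
    simp only [chord]
    module

open Classical in
/-- The points over `x` of the segments between points of `V`. -/
noncomputable def fiberPoints (V : Finset (ℝ × E)) (x : ℝ) : Finset E :=
  ((V ×ˢ V).filter fun p => p.1.1 ≤ x ∧ x ≤ p.2.1).image fun p => chord p.1 p.2 x

lemma mem_fiberPoints {V : Finset (ℝ × E)} {x : ℝ} {y : E} :
    y ∈ fiberPoints V x ↔ ∃ u ∈ V, ∃ v ∈ V, u.1 ≤ x ∧ x ≤ v.1 ∧ chord u v x = y := by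
  simp only [fiberPoints, Finset.mem_image, Finset.mem_filter, Finset.mem_product, Prod.exists]
  grind

/-- The weights left and right of `x` have the same moment `D` about `x`. If `D = 0`, all weight
sits over `x`. Otherwise the point is an average of chords from left points `u` to right points `v`,
with weights `w u * w v * (v.1 - u.1) / D`. -/
lemma mem_convexHull_fiberPoints {V : Finset (ℝ × E)} {p : ℝ × E}
    (hp : p ∈ convexHull ℝ (V : Set (ℝ × E))) :
    p.2 ∈ convexHull ℝ (fiberPoints V p.1 : Set E) := by
  classical
  rw [Finset.mem_convexHull'] at hp
  obtain ⟨w, hw0, hw1, hwp⟩ := hp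
  set x := p.1 with hx
  have hx1 : ∑ v ∈ V, w v * v.1 = x := by
    rw [hx, ← hwp, Prod.fst_sum]; simp
  have hy : ∑ v ∈ V, w v • v.2 = p.2 := by
    conv_rhs => rw [← hwp, Prod.snd_sum]
    simp
  set L := V.filter fun u => u.1 ≤ x with hL
  set R := V.filter fun u => ¬ u.1 ≤ x with hR
  have split1 : ∑ u ∈ L, w u + ∑ v ∈ R, w v = 1 := by
    rw [← hw1]; exact Finset.sum_filter_add_sum_filter_not V _ _
  have splitx : ∑ u ∈ L, w u * u.1 + ∑ v ∈ R, w v * v.1 = x := by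
    rw [← hx1]; exact Finset.sum_filter_add_sum_filter_not V _ _
  have splity : ∑ u ∈ L, w u • u.2 + ∑ v ∈ R, w v • v.2 = p.2 := by
    rw [← hy]; exact Finset.sum_filter_add_sum_filter_not V _ _
  have hLw : ∀ u ∈ L, u ∈ V ∧ u.1 ≤ x := fun u hu => Finset.mem_filter.1 hu
  have hRw : ∀ u ∈ R, u ∈ V ∧ x < u.1 := fun u hu => by
    simpa [not_le] using Finset.mem_filter.1 hu
  set D := ∑ v ∈ R, w v * (v.1 - x) with hD
  have hDL : ∑ u ∈ L, w u * (x - u.1) = D := by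
    simp only [hD, mul_sub, Finset.sum_sub_distrib, ← Finset.sum_mul]
    linear_combination x * split1 - splitx
  have hDnn : ∀ v ∈ R, 0 ≤ w v * (v.1 - x) := fun v hv =>
    mul_nonneg (hw0 v (hRw v hv).1) (sub_nonneg.2 (hRw v hv).2.le)
  have hLnn : ∀ v ∈ L, 0 ≤ w v * (x - v.1) := fun v hv =>
    mul_nonneg (hw0 v (hLw v hv).1) (sub_nonneg.2 (hLw v hv).2)
  have hD0 : 0 ≤ D := Finset.sum_nonneg hDnn
  have hconv := convex_convexHull ℝ (fiberPoints V x : Set E)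
  rcases hD0.eq_or_lt with h0 | hpos
  · have hRz : ∀ v ∈ R, w v = 0 := fun v hv => by
      have := (Finset.sum_eq_zero_iff_of_nonneg hDnn).1 h0.symm v hv
      rcases mul_eq_zero.1 this with h | h
      · exact h
      · have := (hRw v hv).2; linarith
    have hLz := (Finset.sum_eq_zero_iff_of_nonneg hLnn).1 (hDL.trans h0.symm)
    rw [Finset.sum_eq_zero hRz, add_zero] at split1
    rw [Finset.sum_eq_zero (s := R) (fun v hv => by rw [hRz v hv, zero_smul]), add_zero] at splity
    rw [← splity]
    have : ∑ u ∈ L, w u • u.2 = ∑ u ∈ L.filter (fun u => u.1 = x), w u • u.2 := by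
      refine (Finset.sum_filter_of_ne fun u hu hne => ?_).symm
      rcases mul_eq_zero.1 (hLz u hu) with h | h
      · simp [h] at hne
      · linarith
    rw [this]
    refine hconv.sum_mem (fun u hu => hw0 u (hLw u (Finset.mem_filter.1 hu).1).1) ?_ ?_
    · rw [← split1]
      refine Finset.sum_filter_of_ne fun u hu hne => ?_
      rcases mul_eq_zero.1 (hLz u hu) with h | h
      · exact absurd h hne
      · linarith
    · intro u hu
      obtain ⟨hu, hux⟩ := Finset.mem_filter.1 hu
      refine subset_convexHull _ _ (mem_fiberPoints.2 ⟨u, (hLw u hu).1, u, (hLw u hu).1, hux.le,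
        hux.ge, ?_⟩)
      simp [chord]
  · have hsum : ∑ q ∈ L ×ˢ R, w q.1 * w q.2 * (q.2.1 - q.1.1) / D = 1 := by
      rw [← Finset.sum_div, div_eq_one_iff_eq hpos.ne', Finset.sum_product]
      have : ∀ u ∈ L, ∑ v ∈ R, w u * w v * (v.1 - u.1)
          = w u * D + (w u * (x - u.1)) * ∑ v ∈ R, w v := fun u _ => by
        rw [hD, Finset.mul_sum, Finset.mul_sum, ← Finset.sum_add_distrib]
        exact Finset.sum_congr rfl fun v _ => by ring
      rw [Finset.sum_congr rfl this, Finset.sum_add_distrib, ← Finset.sum_mul, ← Finset.sum_mul,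
        hDL]
      linear_combination D * split1
    have hval : ∑ q ∈ L ×ˢ R, (w q.1 * w q.2 * (q.2.1 - q.1.1) / D) • chord q.1 q.2 x = p.2 := by
      rw [Finset.sum_product, ← splity]
      have : ∀ u ∈ L, ∑ v ∈ R, (w u * w v * (v.1 - u.1) / D) • chord u v x
          = w u • u.2 + (w u * (x - u.1) / D) • ∑ v ∈ R, w v • v.2 := fun u hu => by
        have h1 : w u • u.2 = ∑ v ∈ R, (w u * (w v * (v.1 - x)) / D) • u.2 := by
          rw [← Finset.sum_smul, ← Finset.sum_div, ← Finset.mul_sum, ← hD,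
            mul_div_cancel_right₀ _ hpos.ne']
        rw [h1, Finset.smul_sum, ← Finset.sum_add_distrib]
        refine Finset.sum_congr rfl fun v hv => ?_
        have hne : v.1 - u.1 ≠ 0 := by
          have := (hLw u hu).2; have := (hRw v hv).2; intro h; linarith
        have e1 : w u * w v * (v.1 - u.1) / D * ((x - u.1) / (v.1 - u.1)) =
          w u * w v * (x - u.1) / D := by field_simp
        rw [chord, smul_add, smul_smul, e1]
        module
      rw [Finset.sum_congr rfl this, Finset.sum_add_distrib, ← Finset.sum_smul, ← Finset.sum_div,
        hDL, div_self hpos.ne', one_smul]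
    rw [← hval]
    refine hconv.sum_mem ?_ hsum ?_
    · intro q hq
      obtain ⟨h1, h2⟩ := Finset.mem_product.1 hq
      have a1 := hw0 _ (hLw _ h1).1
      have a2 := hw0 _ (hRw _ h2).1
      have a3 : 0 ≤ q.2.1 - q.1.1 := by linarith [(hLw _ h1).2, (hRw _ h2).2]
      positivity
    · intro q hq
      obtain ⟨h1, h2⟩ := Finset.mem_product.1 hq
      exact subset_convexHull _ _ (mem_fiberPoints.2 ⟨q.1, (hLw _ h1).1, q.2, (hRw _ h2).1,
        (hLw _ h1).2, (hRw _ h2).2.le, rfl⟩)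

lemma exists_fiberPoints_ge {V : Finset (ℝ × E)} {p : ℝ × E}
    (hp : p ∈ convexHull ℝ (V : Set (ℝ × E))) (f : E →ₗ[ℝ] ℝ) :
    ∃ y ∈ fiberPoints V p.1, f p.2 ≤ f y :=
  (f.convexOn (convex_convexHull ℝ _)).exists_ge_of_mem_convexHull
    (subset_convexHull ℝ _) (mem_convexHull_fiberPoints hp)

lemma fiberPoints_mem {V : Finset (ℝ × E)} {x : ℝ} {y : E} (hy : y ∈ fiberPoints V x) :
    (x, y) ∈ convexHull ℝ (V : Set (ℝ × E)) := by
  obtain ⟨u, hu, v, hv, h1, h2, rfl⟩ := mem_fiberPoints.1 hy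
  exact chord_mem (convex_convexHull ℝ _) (subset_convexHull ℝ _ hu) (subset_convexHull ℝ _ hv)
    h1 h2

end

/-! ### Neighbouring grid points -/

/-- The largest element of `X` not exceeding `x`; the minimum of `X` if there is none. -/
noncomputable def gridBelow (X : Finset ℝ) (hX : X.Nonempty) (x : ℝ) : ℝ :=
  (insert (X.min' hX) (X.filter (· ≤ x))).max' (Finset.insert_nonempty _ _)

/-- The smallest element of `X` not below `x`; the maximum of `X` if there is none. -/
noncomputable def gridAbove (X : Finset ℝ) (hX : X.Nonempty) (x : ℝ) : ℝ :=
  (insert (X.max' hX) (X.filter (x ≤ ·))).min' (Finset.insert_nonempty _ _)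

section grid
variable {X : Finset ℝ} {hX : X.Nonempty} {x : ℝ}

lemma gridBelow_mem : gridBelow X hX x ∈ X := by
  have := Finset.max'_mem (insert (X.min' hX) (X.filter (· ≤ x))) (Finset.insert_nonempty _ _)
  rcases Finset.mem_insert.1 this with h | h
  · rw [gridBelow, h]; exact X.min'_mem hX
  · exact (Finset.mem_filter.1 h).1

lemma gridAbove_mem : gridAbove X hX x ∈ X := by
  have := Finset.min'_mem (insert (X.max' hX) (X.filter (x ≤ ·))) (Finset.insert_nonempty _ _)
  rcases Finset.mem_insert.1 this with h | h
  · rw [gridAbove, h]; exact X.max'_mem hX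
  · exact (Finset.mem_filter.1 h).1

lemma gridBelow_le {i : ℝ} (hi : i ∈ X) (hix : i ≤ x) : gridBelow X hX x ≤ x :=
  Finset.max'_le _ _ _ fun j hj => by
    rcases Finset.mem_insert.1 hj with h | h
    · rw [h]; exact (X.min'_le i hi).trans hix
    · exact (Finset.mem_filter.1 h).2

lemma le_gridAbove {i : ℝ} (hi : i ∈ X) (hix : x ≤ i) : x ≤ gridAbove X hX x :=
  Finset.le_min' _ _ _ fun j hj => by
    rcases Finset.mem_insert.1 hj with h | h
    · rw [h]; exact hix.trans (X.le_max' i hi)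
    · exact (Finset.mem_filter.1 h).2

lemma le_gridBelow {i : ℝ} (hi : i ∈ X) (hix : i ≤ x) : i ≤ gridBelow X hX x :=
  Finset.le_max' _ _ (Finset.mem_insert_of_mem (Finset.mem_filter.2 ⟨hi, hix⟩))

lemma gridAbove_le {i : ℝ} (hi : i ∈ X) (hix : x ≤ i) : gridAbove X hX x ≤ i :=
  Finset.min'_le _ _ (Finset.mem_insert_of_mem (Finset.mem_filter.2 ⟨hi, hix⟩))

lemma measurable_gridBelow : Measurable (gridBelow X hX) :=
  Monotone.measurable fun _ _ hxy => Finset.max'_subset _ <| Finset.insert_subset_insert _ <|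
    Finset.monotone_filter_right _ fun _ _ h => h.trans hxy

lemma measurable_gridAbove : Measurable (gridAbove X hX) :=
  Monotone.measurable fun _ _ hxy => Finset.min'_subset _ <| Finset.insert_subset_insert _ <|
    Finset.monotone_filter_right _ fun _ _ h => hxy.trans h

end grid

/-! ### Piecewise linear optimal selections -/

section
variable {E : Type*} [NormedAddCommGroup E] [NormedSpace ℝ E]

/-- Piecewise linear interpolation of the values of `c` at the points of `X`. -/
noncomputable def interpolate (X : Finset ℝ) (hX : X.Nonempty) (c : ℝ → E) (x : ℝ) : E :=
  (1 - (x - gridBelow X hX x) / (gridAbove X hX x - gridBelow X hX x)) • c (gridBelow X hX x) +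
    ((x - gridBelow X hX x) / (gridAbove X hX x - gridBelow X hX x)) • c (gridAbove X hX x)

lemma stronglyMeasurable_interpolate [FiniteDimensional ℝ E] (X : Finset ℝ) (hX : X.Nonempty)
    (c : ℝ → E) (hc : ∀ i ∉ X, c i = 0) : StronglyMeasurable (interpolate X hX c) := by
  borelize E
  have := FiniteDimensional.proper ℝ E
  have hcm : Measurable c :=
    (measurable_const (a := (0 : E))).measurable_of_countable_ne <|
      X.countable_toSet.mono fun i hi => by
        by_contra h
        exact hi (hc i h).symm
  have h1 := measurable_gridBelow (X := X) (hX := hX)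
  have h2 := measurable_gridAbove (X := X) (hX := hX)
  have hm : Measurable (interpolate X hX c) := by
    unfold interpolate
    have := hcm.comp h1
    have := hcm.comp h2
    simp only [Function.comp_def] at *
    fun_prop
  exact hm.stronglyMeasurable

/-- The selections that compute a Minkowski integral. -/
def IsSelection (P : Set (ℝ × E)) (s : ℝ → E) : Prop :=
  IntegrableOn s (Prod.fst '' P) ∧ ∀ x ∈ Prod.fst '' P, (x, s x) ∈ P

lemma mem_minkowskiIntegral {P : Set (ℝ × E)} {y : E} :
    y ∈ minkowskiIntegral P ↔ ∃ s, IsSelection P s ∧ ∫ x in Prod.fst '' P, s x = y := by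
  simp only [minkowskiIntegral, IsSelection, Set.mem_ofPred_eq, and_assoc]

omit [NormedSpace ℝ E] in
lemma isCompact_fst_image {P : Set (ℝ × E)} (hP : IsCompact P) : IsCompact (Prod.fst '' P) :=
  hP.image continuous_fst

omit [NormedSpace ℝ E] in
lemma isSelection_of_measurable {P : Set (ℝ × E)} (hP : IsCompact P) {s : ℝ → E}
    (hs : StronglyMeasurable s) (hsP : ∀ x ∈ Prod.fst '' P, (x, s x) ∈ P) : IsSelection P s := by
  refine ⟨?_, hsP⟩
  obtain ⟨C, hC⟩ := (hP.image continuous_snd).isBounded.exists_norm_le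
  have hc := isCompact_fst_image hP
  refine Measure.integrableOn_of_bounded (M := C) hc.measure_lt_top.ne hs.aestronglyMeasurable ?_
  filter_upwards [ae_restrict_mem hc.measurableSet] with x hx
  exact hC _ ⟨_, hsP x hx, rfl⟩

/-- Linear functionals have optimal selections of a polytope, with only finitely many integrals
altogether. -/
lemma exists_finite_optimal [FiniteDimensional ℝ E] (V : Finset (ℝ × E)) (hV : V.Nonempty) :
    ∃ W : Set E, W.Finite ∧ ∀ f : E →ₗ[ℝ] ℝ, ∃ s, IsSelection (convexHull ℝ (V : Set (ℝ × E))) s ∧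
      (∀ p ∈ convexHull ℝ (V : Set (ℝ × E)), f p.2 ≤ f (s p.1)) ∧
      ∫ x in Prod.fst '' convexHull ℝ (V : Set (ℝ × E)), s x ∈ W := by
  classical
  set P := convexHull ℝ (V : Set (ℝ × E)) with hPdef
  have hPc : Convex ℝ P := convex_convexHull ℝ _
  have hPk : IsCompact P := V.finite_toSet.isCompact_convexHull (𝕜 := ℝ)
  set X : Finset ℝ := V.image Prod.fst with hXdef
  have hX : X.Nonempty := hV.image _
  let ext : (∀ i : X, fiberPoints V (i : ℝ)) → ℝ → E := fun c i =>
    if h : i ∈ X then (c ⟨i, h⟩ : E) else 0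
  -- One integral for each choice of a fibre point over every grid value: a finite set independent
  -- of `f`.
  refine ⟨Set.range fun c : (∀ i : X, fiberPoints V (i : ℝ)) =>
    ∫ x in Prod.fst '' P, interpolate X hX (ext c) x, Set.finite_range _, fun f => ?_⟩
  have hne : ∀ i : X, ∃ y ∈ fiberPoints V (i : ℝ), ∀ z ∈ fiberPoints V (i : ℝ), f z ≤ f y := by
    intro i
    refine Finset.exists_max_image _ _ ?_
    obtain ⟨v, hv, hvi⟩ := Finset.mem_image.1 i.2
    exact ⟨_, mem_fiberPoints.2 ⟨v, hv, v, hv, hvi.le, hvi.ge, rfl⟩⟩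
  choose c hcm hc using hne
  set e := ext fun i => ⟨c i, hcm i⟩ with he
  have hem : ∀ i ∈ X, e i ∈ fiberPoints V i := fun i hi => by
    simp only [he, ext, hi, dif_pos]; exact hcm ⟨i, hi⟩
  have hemax : ∀ i ∈ X, ∀ z ∈ fiberPoints V i, f z ≤ f (e i) := fun i hi z hz => by
    simp only [he, ext, hi, dif_pos]; exact hc ⟨i, hi⟩ z hz
  have hgrid : ∀ x, ∀ u ∈ V, ∀ v ∈ V, u.1 ≤ x → x ≤ v.1 →
      u.1 ≤ gridBelow X hX x ∧ gridBelow X hX x ≤ x ∧ x ≤ gridAbove X hX x ∧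
      gridAbove X hX x ≤ v.1 := fun x u hu v hv hux hxv => by
    have h1 : u.1 ∈ X := Finset.mem_image_of_mem _ hu
    have h2 : v.1 ∈ X := Finset.mem_image_of_mem _ hv
    exact ⟨le_gridBelow h1 hux, gridBelow_le h1 hux, le_gridAbove h2 hxv, gridAbove_le h2 hxv⟩
  have hfib : ∀ p ∈ P, ∃ y ∈ fiberPoints V p.1, f p.2 ≤ f y := fun p hp =>
    exists_fiberPoints_ge hp f
  refine ⟨interpolate X hX e, isSelection_of_measurable hPk
    (stronglyMeasurable_interpolate X hX e fun i hi => by simp [he, ext, hi]) ?_, ?_,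
    ⟨fun i => ⟨c i, hcm i⟩, rfl⟩⟩
  · rintro _ ⟨p, hp, rfl⟩
    obtain ⟨y, hy, -⟩ := hfib p hp
    obtain ⟨u, hu, v, hv, hux, hxv, -⟩ := mem_fiberPoints.1 hy
    obtain ⟨-, h2, h3, -⟩ := hgrid _ u hu v hv hux hxv
    have hb := fiberPoints_mem (hem _ (gridBelow_mem (X := X) (hX := hX) (x := p.1)))
    have ha := fiberPoints_mem (hem _ (gridAbove_mem (X := X) (hX := hX) (x := p.1)))
    convert chord_mem hPc hb ha h2 h3 using 2
    simp only [interpolate, chord]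
    module
  · intro p hp
    obtain ⟨y, hy, hpy⟩ := hfib p hp
    obtain ⟨u, hu, v, hv, hux, hxv, rfl⟩ := mem_fiberPoints.1 hy
    obtain ⟨h1, h2, h3, h4⟩ := hgrid _ u hu v hv hux hxv
    refine hpy.trans ?_
    -- The chord has no breakpoint between the neighbouring grid points, so it suffices to compare
    -- with the optimal values at these two.
    rw [chord_interpolate u v (i := gridBelow X hX p.1) (j := gridAbove X hX p.1)
      fun h => le_antisymm (h ▸ h3) h2]
    have hb := hemax _ (gridBelow_mem (X := X) (hX := hX) (x := p.1)) _
      (mem_fiberPoints.2 ⟨u, hu, v, hv, h1, h2.trans hxv, rfl⟩)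
    have ha := hemax _ (gridAbove_mem (X := X) (hX := hX) (x := p.1)) _
      (mem_fiberPoints.2 ⟨u, hu, v, hv, hux.trans h3, h4, rfl⟩)
    simp only [interpolate, map_add, map_smul, smul_eq_mul]
    have hd : 0 ≤ gridAbove X hX p.1 - gridBelow X hX p.1 := by linarith
    have hn : 0 ≤ p.1 - gridBelow X hX p.1 := by linarith
    have ht0 := div_nonneg hn hd
    have ht1 : (p.1 - gridBelow X hX p.1) / (gridAbove X hX p.1 - gridBelow X hX p.1) ≤ 1 :=
      div_le_one_of_le₀ (by linarith) hd
    gcongr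
end

lemma fst_image_map {E F : Type*} (T : E → F) (P : Set (ℝ × E)) :
    Prod.fst '' (Prod.map id T '' P) = Prod.fst '' P := by
  rw [Set.image_image]; rfl

/-! ### Polytopes and their Minkowski integrals -/

section polytope
variable {E F : Type*} [AddCommGroup E] [Module ℝ E] [AddCommGroup F] [Module ℝ F]

lemma IsPolytope.convex {P : Set E} (hP : IsPolytope P) : Convex ℝ P := by
  obtain ⟨V, -, rfl⟩ := hP
  exact convex_convexHull ℝ _

lemma IsPolytope.nonempty {P : Set E} (hP : IsPolytope P) : P.Nonempty := by
  obtain ⟨V, hV, rfl⟩ := hP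
  exact convexHull_nonempty_iff.2 hV

lemma isPolytope_convexHull {S : Set E} (hS : S.Finite) (hne : S.Nonempty) :
    IsPolytope (convexHull ℝ S) :=
  ⟨hS.toFinset, by simpa using hne, by simp⟩

end polytope

section
variable {E F : Type*} [NormedAddCommGroup E] [NormedSpace ℝ E]
  [NormedAddCommGroup F] [NormedSpace ℝ F]

lemma IsPolytope.isCompact {P : Set E} (hP : IsPolytope P) : IsCompact P := by
  obtain ⟨V, -, rfl⟩ := hP
  exact V.finite_toSet.isCompact_convexHull (𝕜 := ℝ)

lemma subset_of_forall_exists_ge {K L : Set E} (hL : Convex ℝ L) (hLc : IsClosed L)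
    (h : ∀ f : StrongDual ℝ E, ∀ y ∈ K, ∃ z ∈ L, f y ≤ f z) : K ⊆ L := by
  intro y hy
  by_contra hyL
  obtain ⟨f, u, h1, h2⟩ := geometric_hahn_banach_closed_point hL hLc hyL
  obtain ⟨z, hz, hyz⟩ := h f y hy
  linarith [h1 z hz]

/-- Selections may be averaged pointwise because `P` has convex fibres. -/
lemma convex_minkowskiIntegral {P : Set (ℝ × E)} (hP : Convex ℝ P) :
    Convex ℝ (minkowskiIntegral P) := by
  intro y hy z hz a b ha hb hab
  obtain ⟨s, ⟨hs, hsP⟩, rfl⟩ := mem_minkowskiIntegral.1 hy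
  obtain ⟨t, ⟨ht, htP⟩, rfl⟩ := mem_minkowskiIntegral.1 hz
  refine mem_minkowskiIntegral.2 ⟨fun x => a • s x + b • t x,
    ⟨(hs.smul a).add (ht.smul b), fun x hx => ?_⟩, ?_⟩
  · convert hP (hsP x hx) (htP x hx) ha hb hab using 1
    ext <;> simp [← add_mul, hab]
  · exact (integral_add (hs.smul a) (ht.smul b)).trans (by simp only [Pi.smul_apply, integral_smul])

lemma IsSelection.map {P : Set (ℝ × E)} {R : Set (ℝ × F)} {s : ℝ → E} (hs : IsSelection P s)
    (T : E →L[ℝ] F) (hPR : Set.MapsTo (Prod.map id T) P R)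
    (hR : Prod.fst '' R = Prod.fst '' P) : IsSelection R (fun x => T (s x)) := by
  rw [IsSelection, hR]
  exact ⟨T.integrable_comp hs.1, fun x hx => hPR (hs.2 x hx)⟩

variable [FiniteDimensional ℝ E] [FiniteDimensional ℝ F]

lemma IsSelection.apply_integral {P : Set (ℝ × E)} {s : ℝ → E} (hs : IsSelection P s)
    (f : E →L[ℝ] F) :
    f (∫ x in Prod.fst '' P, s x) = ∫ x in Prod.fst '' P, f (s x) := by
  have := FiniteDimensional.complete ℝ E
  have := FiniteDimensional.complete ℝ F
  exact (f.integral_comp_comm hs.1).symm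

lemma IsPolytope.exists_optimal {P : Set (ℝ × E)} (hP : IsPolytope P) (f : E →L[ℝ] ℝ) :
    ∃ s, IsSelection P s ∧ ∀ p ∈ P, f p.2 ≤ f (s p.1) := by
  obtain ⟨V, hV, rfl⟩ := hP
  obtain ⟨W, -, hW⟩ := exists_finite_optimal V hV
  obtain ⟨s, hs, hsf, -⟩ := hW f
  exact ⟨s, hs, hsf⟩

lemma IsSelection.apply_integral_le {P : Set (ℝ × E)} (hP : IsCompact P) {s t : ℝ → E}
    (hs : IsSelection P s) (ht : IsSelection P t) (f : E →L[ℝ] ℝ)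
    (hf : ∀ p ∈ P, f p.2 ≤ f (t p.1)) :
    f (∫ x in Prod.fst '' P, s x) ≤ f (∫ x in Prod.fst '' P, t x) := by
  rw [hs.apply_integral, ht.apply_integral]
  exact setIntegral_mono_on (f.integrable_comp hs.1) (f.integrable_comp ht.1)
    (isCompact_fst_image hP).measurableSet fun x hx => hf _ (hs.2 x hx)

/-- The Minkowski integral of a polytope over an interval is a polytope. -/
theorem isPolytope_minkowskiIntegral {P : Set (ℝ × E)} (hP : IsPolytope P) :
    IsPolytope (minkowskiIntegral P) := by
  have hPk := hP.isCompact
  have hPc := hP.convex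
  obtain ⟨V, hV, hPV⟩ := hP
  obtain ⟨W, hWf, hW⟩ := exists_finite_optimal V hV
  rw [← hPV] at hW
  -- Some points of `W` are not known to lie in the Minkowski integral; the optimal ones do.
  have hfin : (W ∩ minkowskiIntegral P).Finite := hWf.subset Set.inter_subset_left
  have key : ∀ f : StrongDual ℝ E, ∃ z ∈ W ∩ minkowskiIntegral P,
      ∀ y ∈ minkowskiIntegral P, f y ≤ f z := fun f => by
    obtain ⟨s, hs, hsf, hsW⟩ := hW f
    refine ⟨_, ⟨hsW, mem_minkowskiIntegral.2 ⟨s, hs, rfl⟩⟩, fun y hy => ?_⟩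
    obtain ⟨t, ht, rfl⟩ := mem_minkowskiIntegral.1 hy
    exact ht.apply_integral_le hPk hs f hsf
  have heq : minkowskiIntegral P = convexHull ℝ (W ∩ minkowskiIntegral P) := by
    refine subset_antisymm (subset_of_forall_exists_ge (convex_convexHull ℝ _)
      (hfin.isCompact_convexHull (𝕜 := ℝ)).isClosed fun f y hy => ?_)
      (convexHull_min Set.inter_subset_right (convex_minkowskiIntegral hPc))
    obtain ⟨z, hz, hzf⟩ := key f
    exact ⟨z, subset_convexHull ℝ _ hz, hzf y hy⟩
  rw [heq]
  obtain ⟨z, hz, -⟩ := key 0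
  exact isPolytope_convexHull hfin ⟨z, hz⟩

lemma map_mem_minkowskiIntegral {P : Set (ℝ × E)} {R : Set (ℝ × F)} (T : E →L[ℝ] F)
    (hPR : Set.MapsTo (Prod.map id T) P R) (hR : Prod.fst '' R = Prod.fst '' P) {y : E}
    (hy : y ∈ minkowskiIntegral P) : T y ∈ minkowskiIntegral R := by
  obtain ⟨s, hs, rfl⟩ := mem_minkowskiIntegral.1 hy
  exact mem_minkowskiIntegral.2 ⟨_, hs.map T hPR hR, by rw [hs.apply_integral, hR]⟩

/-- Minkowski integrals of polytopes commute with linear maps of the fibers. -/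
theorem minkowskiIntegral_image {P : Set (ℝ × E)} (hP : IsPolytope P) (T : E →L[ℝ] F) :
    minkowskiIntegral (Prod.map id T '' P) = T '' minkowskiIntegral P := by
  have hI := isPolytope_minkowskiIntegral hP
  -- No measurable lift of a selection is needed: a selection of `P` optimal for `f ∘ T` pushes
  -- forward to one of the image optimal for `f`.
  refine subset_antisymm (subset_of_forall_exists_ge
    (hI.convex.linear_image T.toLinearMap) (hI.isCompact.image T.continuous).isClosed
    fun f y hy => ?_) ?_
  · obtain ⟨s, hs, rfl⟩ := mem_minkowskiIntegral.1 hy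
    obtain ⟨t, ht, hopt⟩ := hP.exists_optimal (f.comp T)
    refine ⟨_, ⟨_, mem_minkowskiIntegral.2 ⟨t, ht, rfl⟩, rfl⟩, ?_⟩
    have hTt := ht.map T (Set.mapsTo_image _ P) (fst_image_map T P)
    have := hs.apply_integral_le (hP.isCompact.image (by fun_prop)) hTt f (by
      rintro _ ⟨p, hp, rfl⟩
      exact hopt p hp)
    rw [ht.apply_integral, ← fst_image_map T P]
    exact this
  · rintro _ ⟨y, hy, rfl⟩
    exact map_mem_minkowskiIntegral T (Set.mapsTo_image _ _) (fst_image_map _ _) hy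

/-- A linear equation on the fibers yields one on the Minkowski integral. -/
lemma apply_eq_of_mem_minkowskiIntegral {P : Set (ℝ × E)} (hP : IsCompact P) (f : E →L[ℝ] F)
    (g : ℝ → F) (h : ∀ p ∈ P, f p.2 = g p.1) {y : E} (hy : y ∈ minkowskiIntegral P) :
    f y = ∫ x in Prod.fst '' P, g x := by
  obtain ⟨s, hs, rfl⟩ := mem_minkowskiIntegral.1 hy
  rw [hs.apply_integral]
  exact setIntegral_congr_fun (isCompact_fst_image hP).measurableSet fun x hx => h _ (hs.2 x hx)

lemma apply_nonneg_of_mem_minkowskiIntegral {P : Set (ℝ × E)} (hP : IsCompact P)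
    (f : E →L[ℝ] ℝ) (h : ∀ p ∈ P, 0 ≤ f p.2) {y : E} (hy : y ∈ minkowskiIntegral P) :
    0 ≤ f y := by
  obtain ⟨s, hs, rfl⟩ := mem_minkowskiIntegral.1 hy
  rw [hs.apply_integral]
  exact setIntegral_nonneg (isCompact_fst_image hP).measurableSet fun x hx => h _ (hs.2 x hx)

end

/-! ### Support functions of homogeneous polytopes -/

section supportFunction
variable {ι : Type*} [Fintype ι]

/-- The linear functional on `ℝ^ι` with coefficients `γ`. -/
noncomputable def pairing (γ : ι → ℝ) : (ι → ℝ) →L[ℝ] ℝ :=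
  ∑ i, γ i • ContinuousLinearMap.proj i

lemma pairing_apply (γ y : ι → ℝ) : pairing γ y = ∑ i, γ i * y i := by
  simp [pairing]

lemma supportFunction_eq_of_forall_le {Q : Set (ι → ℝ)} {γ z : ι → ℝ} (hz : z ∈ Q)
    (h : ∀ y ∈ Q, pairing γ y ≤ pairing γ z) : supportFunction Q γ = pairing γ z := by
  rw [pairing_apply]
  refine IsGreatest.csSup_eq ⟨⟨z, hz, rfl⟩, ?_⟩
  rintro _ ⟨y, hy, rfl⟩
  simpa only [pairing_apply] using h y hy

lemma IsPolytope.exists_supportFunction_eq {Q : Set (ι → ℝ)} (hQ : IsPolytope Q) (γ : ι → ℝ) :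
    ∃ z ∈ Q, supportFunction Q γ = pairing γ z ∧ ∀ y ∈ Q, pairing γ y ≤ pairing γ z := by
  obtain ⟨z, hz, hmax⟩ := hQ.isCompact.exists_isMaxOn hQ.nonempty (pairing γ).continuous.continuousOn
  exact ⟨z, hz, supportFunction_eq_of_forall_le hz hmax, hmax⟩

lemma IsPolytope.supportFunction_one {Q : Set (ι → ℝ)} (hQ : IsPolytope Q) {c : ℝ}
    (hc : ∀ y ∈ Q, ∑ i, y i = c) : supportFunction Q 1 = c := by
  obtain ⟨z, hz, h, -⟩ := hQ.exists_supportFunction_eq 1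
  rw [h, pairing_apply, ← hc z hz]
  simp

lemma IsPolytope.subset_of_supportFunction_eq {K L : Set (ι → ℝ)} (hK : IsPolytope K)
    (hL : IsPolytope L) (hKh : IsHomogeneous K) (hLh : IsHomogeneous L)
    (h : ∀ γ : ι → ℝ, (∀ i, 0 ≤ γ i) → supportFunction K γ = supportFunction L γ) : K ⊆ L := by
  classical
  obtain ⟨c, hc⟩ := hKh
  obtain ⟨d, hd⟩ := hLh
  have hcd : c = d := by
    rw [← hK.supportFunction_one hc, ← hL.supportFunction_one hd]
    exact h 1 fun _ => zero_le_one
  refine subset_of_forall_exists_ge hL.convex hL.isCompact.isClosed fun f y hy => ?_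
  set γ : ι → ℝ := fun i => f (Pi.single i 1) with hγ
  have hf : ∀ z : ι → ℝ, f z = ∑ i, γ i * z i := fun z => by
    conv_lhs => rw [pi_eq_sum_univ' z]
    simp [hγ, mul_comm, map_sum]
  -- Large enough to make every `γ i + t` non-negative; by homogeneity the shift changes both
  -- support functions by the same constant.
  set t : ℝ := ∑ i, |γ i|
  have ht : ∀ i, 0 ≤ γ i + t := fun i => by
    have := Finset.single_le_sum (f := fun i => |γ i|) (fun _ _ => abs_nonneg _) (Finset.mem_univ i)
    linarith [neg_abs_le (γ i)]
  have hpair : ∀ z : ι → ℝ, pairing (fun i => γ i + t) z = f z + t * ∑ i, z i := fun z => by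
    rw [pairing_apply, hf, Finset.mul_sum, ← Finset.sum_add_distrib]
    exact Finset.sum_congr rfl fun i _ => by ring
  obtain ⟨y', -, hy1, hy2⟩ := hK.exists_supportFunction_eq fun i => γ i + t
  obtain ⟨z, hz, hz1, -⟩ := hL.exists_supportFunction_eq fun i => γ i + t
  refine ⟨z, hz, ?_⟩
  have := hy2 y hy
  rw [← hy1, h _ ht, hz1, hpair, hpair, hc y hy, hd z hz, hcd] at this
  linarith

/-- A homogeneous polytope is determined by its support function on the non-negative covectors. -/
theorem IsPolytope.eq_of_supportFunction_eq {K L : Set (ι → ℝ)} (hK : IsPolytope K)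
    (hL : IsPolytope L) (hKh : IsHomogeneous K) (hLh : IsHomogeneous L)
    (h : ∀ γ : ι → ℝ, (∀ i, 0 ≤ γ i) → supportFunction K γ = supportFunction L γ) : K = L :=
  (hK.subset_of_supportFunction_eq hL hKh hLh h).antisymm
    (hL.subset_of_supportFunction_eq hK hLh hKh fun γ hγ => (h γ hγ).symm)

end supportFunction

/-- The area between the graph of a non-negative function and the axis. -/
lemma area_subgraph {I : Set ℝ} (hI : MeasurableSet I) {h : ℝ → ℝ} (hint : IntegrableOn h I)
    (h0 : ∀ x ∈ I, 0 ≤ h x) {S : Set (ℝ × ℝ)} (hSm : MeasurableSet S)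
    (hS : ∀ x y, (x, y) ∈ S ↔ x ∈ I ∧ 0 ≤ y ∧ y ≤ h x) : area S = ∫ x in I, h x := by
  classical
  have h1 : volume S = ∫⁻ x in I, ENNReal.ofReal (h x) := by
    rw [Measure.volume_eq_prod, Measure.prod_apply hSm, ← lintegral_indicator hI]
    congr 1
    ext x
    by_cases hx : x ∈ I
    · have : Prod.mk x ⁻¹' S = Set.Icc 0 (h x) := by
        ext y; simp [hS, hx]
      simp [this, hx]
    · have : Prod.mk x ⁻¹' S = ∅ := by
        ext y; simp [hS, hx]
      simp [this, hx]
  rw [area, h1, integral_eq_lintegral_of_nonneg_ae _ hint.aestronglyMeasurable]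
  filter_upwards [ae_restrict_mem hI] with x hx using h0 x hx

/-! ### The polytopes of the theorem and homogeneity -/

section secondary
variable (A : Finset ℤ)

lemma isPolytope_Omega : IsPolytope (Omega A) :=
  isPolytope_convexHull ((Set.finite_range _).union (Set.finite_singleton _)) (by simp)

lemma isPolytope_DeltaBar (γ : A → ℝ) : IsPolytope (DeltaBar A γ) :=
  isPolytope_convexHull (((Set.finite_range _).union (Set.finite_range _)).union
    (Set.finite_singleton _)) (by simp)

lemma isPolytope_secondary : IsPolytope (secondary A) :=
  isPolytope_minkowskiIntegral (isPolytope_Omega A)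

lemma isPolytope_Sigma : IsPolytope (Sigma A) :=
  isPolytope_minkowskiIntegral (isPolytope_secondary A)

lemma isPolytope_PBar (γ : A → ℝ) : IsPolytope (PBar A γ) :=
  isPolytope_minkowskiIntegral (isPolytope_DeltaBar A γ)

lemma add_sum_eq_one_of_mem_Omega {p : ℝ × (ℝ × (A → ℝ))} (hp : p ∈ Omega A) :
    p.2.1 + ∑ a, p.2.2 a = 1 := by
  have hconv : Convex ℝ {p : ℝ × (ℝ × (A → ℝ)) | p.2.1 + pairing 1 p.2.2 = 1} :=
    convex_hyperplane (f := fun p : ℝ × (ℝ × (A → ℝ)) => p.2.1 + pairing 1 p.2.2)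
      ⟨fun p q => by simp; ring, fun c p => by simp; ring⟩ 1
  have := convexHull_min (s := _) (by
    rintro _ (⟨a, rfl⟩ | rfl)
    · simp [pairing_apply]
    · simp [pairing_apply]) hconv hp
  simpa [pairing_apply] using this

/-- On `secondary A` the coordinates add up to the length of the projection of `Omega A`. -/
lemma add_sum_of_mem_secondary {q : ℝ × (A → ℝ)} (hq : q ∈ secondary A) :
    q.1 + ∑ a, q.2 a = ∫ _ in Prod.fst '' Omega A, (1 : ℝ) := by
  have := apply_eq_of_mem_minkowskiIntegral (isPolytope_Omega A).isCompact
    (ContinuousLinearMap.fst ℝ ℝ (A → ℝ) +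
      (pairing 1).comp (ContinuousLinearMap.snd ℝ ℝ (A → ℝ))) (fun _ => 1)
    (fun p hp => by simpa [pairing_apply] using add_sum_eq_one_of_mem_Omega A hp) hq
  simpa [pairing_apply] using this

/-- On the fibre of `secondary A` over `x` the remaining coordinates add up to a constant minus `x`;
integrate this over `x`. -/
lemma isHomogeneous_Sigma : IsHomogeneous (Sigma A) := by
  refine ⟨∫ x in Prod.fst '' secondary A, ((∫ _ in Prod.fst '' Omega A, (1 : ℝ)) - x),
    fun y hy => ?_⟩
  have := apply_eq_of_mem_minkowskiIntegral (isPolytope_secondary A).isCompact (pairing 1)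
    (fun x => (∫ _ in Prod.fst '' Omega A, (1 : ℝ)) - x)
    (fun q hq => by
      rw [← add_sum_of_mem_secondary A hq, pairing_apply]
      simp) hy
  simpa only [pairing_apply, Pi.one_apply, one_mul] using this

/-! ### The lift `OmegaBar` and the area formula -/

variable {A} (γ : A → ℝ)

/-- The points `(x, (y, σ), z)` with `(x, y, σ) ∈ Omega A` and `0 ≤ z ≤ ∑ a, γ a * σ a`, given as
a convex hull. -/
def OmegaBar : Set (ℝ × ((ℝ × (A → ℝ)) × ℝ)) :=
  convexHull ℝ (Set.range (fun a : A =>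
      (((a : ℤ) : ℝ), (((0 : ℝ), (Pi.single a 1 : A → ℝ)), (0 : ℝ)))) ∪
    Set.range (fun a : A => (((a : ℤ) : ℝ), (((0 : ℝ), (Pi.single a 1 : A → ℝ)), γ a))) ∪
    {((0 : ℝ), (((1 : ℝ), (0 : A → ℝ)), (0 : ℝ)))})

lemma isPolytope_OmegaBar : IsPolytope (OmegaBar γ) :=
  isPolytope_convexHull (((Set.finite_range _).union (Set.finite_range _)).union
    (Set.finite_singleton _)) (by simp)

lemma map_image_convexHull {E F : Type*} [NormedAddCommGroup E] [NormedSpace ℝ E]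
    [NormedAddCommGroup F] [NormedSpace ℝ F] (T : E →L[ℝ] F) (S : Set (ℝ × E)) :
    Prod.map id T '' convexHull ℝ S = convexHull ℝ (Prod.map id T '' S) :=
  (LinearMap.prodMap LinearMap.id T.toLinearMap).image_convexHull S

/-- The projection `((y, σ), z) ↦ (y, z)`. -/
noncomputable def forgetFiber (ι : Type*) [Fintype ι] : (ℝ × (ι → ℝ)) × ℝ →L[ℝ] ℝ × ℝ :=
  (ContinuousLinearMap.fst ℝ ℝ (ι → ℝ)).prodMap (ContinuousLinearMap.id ℝ ℝ)

lemma forgetFiber_image_OmegaBar :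
    Prod.map id (forgetFiber A) '' OmegaBar γ = DeltaBar A γ := by
  rw [OmegaBar, map_image_convexHull, DeltaBar, Set.image_union, Set.image_union,
    ← Set.range_comp, ← Set.range_comp, Set.image_singleton]
  rfl

lemma fst_image_OmegaBar :
    Prod.map id (ContinuousLinearMap.fst ℝ (ℝ × (A → ℝ)) ℝ) '' OmegaBar γ = Omega A := by
  rw [OmegaBar, map_image_convexHull, Omega, Set.image_union, Set.image_union,
    ← Set.range_comp, ← Set.range_comp, Set.image_singleton]
  congr 2
  exact Set.union_self _

lemma fst_image_DeltaBar : Prod.fst '' DeltaBar A γ = Prod.fst '' Omega A := by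
  rw [← forgetFiber_image_OmegaBar, ← fst_image_OmegaBar γ, fst_image_map, fst_image_map]

variable {γ}

lemma bounds_of_mem_OmegaBar (hγ : ∀ a, 0 ≤ γ a) {p : ℝ × ((ℝ × (A → ℝ)) × ℝ)}
    (hp : p ∈ OmegaBar γ) : 0 ≤ p.2.2 ∧ p.2.2 ≤ pairing γ p.2.1.2 := by
  have hc1 : Convex ℝ {p : ℝ × ((ℝ × (A → ℝ)) × ℝ) | 0 ≤ p.2.2} :=
    convex_halfSpace_ge (f := fun p : ℝ × ((ℝ × (A → ℝ)) × ℝ) => p.2.2)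
      ⟨fun _ _ => rfl, fun _ _ => rfl⟩ 0
  have hc2 : Convex ℝ {p : ℝ × ((ℝ × (A → ℝ)) × ℝ) | 0 ≤ pairing γ p.2.1.2 - p.2.2} :=
    convex_halfSpace_ge (f := fun p : ℝ × ((ℝ × (A → ℝ)) × ℝ) => pairing γ p.2.1.2 - p.2.2)
      ⟨fun p q => by simp; ring, fun c p => by simp; ring⟩ 0
  have := convexHull_min (by
    rintro _ ((⟨a, rfl⟩ | ⟨a, rfl⟩) | rfl) <;> simp [pairing_apply, Pi.single_apply, hγ])
    (hc1.inter hc2) hp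
  exact ⟨this.1, sub_nonneg.1 this.2⟩

/-- `PBar A γ` is the region under the maximum of `γ` on the fibers of `secondary A`. -/
lemma mem_PBar_iff (hγ : ∀ a, 0 ≤ γ a) {y z : ℝ} :
    (y, z) ∈ PBar A γ ↔ ∃ σ, (y, σ) ∈ secondary A ∧ 0 ≤ z ∧ z ≤ pairing γ σ := by
  have hR := isPolytope_OmegaBar γ
  constructor
  · intro h
    rw [PBar, ← forgetFiber_image_OmegaBar, minkowskiIntegral_image hR] at h
    obtain ⟨⟨⟨y', σ⟩, z'⟩, hr, hyz⟩ := h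
    obtain ⟨rfl, rfl⟩ : y' = y ∧ z' = z := Prod.mk.inj hyz
    refine ⟨σ, ?_, ?_, ?_⟩
    · rw [secondary, ← fst_image_OmegaBar γ, minkowskiIntegral_image hR]
      exact ⟨_, hr, rfl⟩
    · exact apply_nonneg_of_mem_minkowskiIntegral hR.isCompact (ContinuousLinearMap.snd ℝ _ ℝ)
        (fun p hp => (bounds_of_mem_OmegaBar hγ hp).1) hr
    · exact sub_nonneg.1 <| apply_nonneg_of_mem_minkowskiIntegral hR.isCompact
        ((pairing γ).comp ((ContinuousLinearMap.snd ℝ ℝ (A → ℝ)).comp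
          (ContinuousLinearMap.fst ℝ _ ℝ)) - ContinuousLinearMap.snd ℝ _ ℝ)
        (fun p hp => sub_nonneg.2 (bounds_of_mem_OmegaBar hγ hp).2) hr
  · rintro ⟨σ, hσ, hz0, hz⟩
    -- Such a `δ` maps the generators of `Omega A` to generators of `DeltaBar A γ`. The choices `0`
    -- and `γ` give the two ends of a vertical segment through `(y, z)`.
    have hpush : ∀ δ : A → ℝ, (∀ a, δ a = 0 ∨ δ a = γ a) → (y, pairing δ σ) ∈ PBar A γ := by
      intro δ hδ
      refine map_mem_minkowskiIntegral (P := Omega A) ((ContinuousLinearMap.fst ℝ ℝ (A → ℝ)).prod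
        ((pairing δ).comp (ContinuousLinearMap.snd ℝ ℝ (A → ℝ)))) ?_ (fst_image_DeltaBar γ) hσ
      rw [Set.mapsTo_iff_image_subset, Omega, map_image_convexHull]
      refine convexHull_mono ?_
      rintro _ ⟨_, ⟨a, rfl⟩ | rfl, rfl⟩
      · rcases hδ a with h | h
        · exact Or.inl (Or.inl ⟨a, by simp [pairing_apply, Pi.single_apply, h]⟩)
        · exact Or.inl (Or.inr ⟨a, by simp [pairing_apply, Pi.single_apply, h]⟩)
      · exact Or.inr (by simp)
    have h0 := hpush 0 fun a => Or.inl rfl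
    have h1 := hpush γ fun a => Or.inr rfl
    have hc : 0 ≤ pairing γ σ := hz0.trans hz
    have := (isPolytope_PBar A γ).convex.add_smul_sub_mem h0 h1 (t := z / pairing γ σ)
      ⟨div_nonneg hz0 hc, div_le_one_of_le₀ hz hc⟩
    convert this using 1
    -- If the denominator vanishes, then so does `z`.
    have : z / pairing γ σ * pairing γ σ = z :=
      div_mul_cancel_of_imp fun h => le_antisymm (h ▸ hz) hz0
    ext
    · simp
    · simp [this, pairing_apply 0]

lemma pairing_nonneg_of_mem_secondary (hγ : ∀ a, 0 ≤ γ a) {q : ℝ × (A → ℝ)}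
    (hq : q ∈ secondary A) : 0 ≤ pairing γ q.2 := by
  refine apply_nonneg_of_mem_minkowskiIntegral (isPolytope_Omega A).isCompact
    ((pairing γ).comp (ContinuousLinearMap.snd ℝ ℝ (A → ℝ))) (fun p hp => ?_) hq
  rw [← fst_image_OmegaBar γ] at hp
  obtain ⟨r, hr, rfl⟩ := hp
  obtain ⟨h0, h1⟩ := bounds_of_mem_OmegaBar hγ hr
  exact h0.trans h1

/-- Both sides equal the integral of `pairing γ (t x)` for a fibrewise optimal selection `t` of
`secondary A`. -/
lemma supportFunction_Sigma (hγ : ∀ a, 0 ≤ γ a) :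
    supportFunction (Sigma A) γ = area (PBar A γ) := by
  have hS := isPolytope_secondary A
  obtain ⟨t, ht, hopt⟩ := hS.exists_optimal (pairing γ)
  have hP := isPolytope_PBar A γ
  rw [area_subgraph (isCompact_fst_image hS.isCompact).measurableSet
    ((pairing γ).integrable_comp ht.1) (fun x hx => ?_) hP.isCompact.measurableSet
    (fun y z => ?_), ← ht.apply_integral (pairing γ)]
  · refine supportFunction_eq_of_forall_le (mem_minkowskiIntegral.2 ⟨t, ht, rfl⟩) fun y hy => ?_
    obtain ⟨s, hs, rfl⟩ := mem_minkowskiIntegral.1 hy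
    exact hs.apply_integral_le hS.isCompact ht _ hopt
  · exact pairing_nonneg_of_mem_secondary hγ (ht.2 x hx)
  · rw [mem_PBar_iff hγ]
    constructor
    · rintro ⟨σ, hσ, h0, hz⟩
      exact ⟨⟨_, hσ, rfl⟩, h0, hz.trans (hopt _ hσ)⟩
    · rintro ⟨hy, h0, hz⟩
      exact ⟨_, ht.2 y hy, h0, hz⟩

end secondary
end MinkowskiInt

theorem lemma3 (A : Finset ℤ) (hA0 : (0 : ℤ) ∉ A) (hA : affineSpan ℤ (A : Set ℤ) = ⊤) :
    MinkowskiInt.IsPolytope (MinkowskiInt.Sigma A) ∧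
    MinkowskiInt.IsHomogeneous (MinkowskiInt.Sigma A) ∧
    (∀ γ : A → ℝ, (∀ a, 0 ≤ γ a) →
      MinkowskiInt.supportFunction (MinkowskiInt.Sigma A) γ =
        MinkowskiInt.area (MinkowskiInt.PBar A γ)) ∧
    (∀ Q : Set (A → ℝ), MinkowskiInt.IsPolytope Q → MinkowskiInt.IsHomogeneous Q →
      (∀ γ : A → ℝ, (∀ a, 0 ≤ γ a) →
        MinkowskiInt.supportFunction Q γ = MinkowskiInt.area (MinkowskiInt.PBar A γ)) →
      Q = MinkowskiInt.Sigma A) :=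
  ⟨MinkowskiInt.isPolytope_Sigma A, MinkowskiInt.isHomogeneous_Sigma A,
    fun _ hγ => MinkowskiInt.supportFunction_Sigma hγ,
    fun _ hQ hQh h => hQ.eq_of_supportFunction_eq (MinkowskiInt.isPolytope_Sigma A) hQh
      (MinkowskiInt.isHomogeneous_Sigma A) fun γ hγ =>
        (h γ hγ).trans (MinkowskiInt.supportFunction_Sigma hγ).symm⟩
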